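/- Let $(X,\omega,J)$ be a Kähler manifold of complex dimension $n$ (with $\omega(v,Jv)>0$ for $v\neq 0$ and Riemannian metric $g(u,v)=\omega(u,Jv)$), let $\nabla$ be the Levi-Civita connection of $g$, extended complex-linearly to the complexified cotangent bundle $T^*X_{\mathbb C}$, and let $\nabla^{0,1}$ denote its $(0,1)$-part, i.e. $\nabla^{0,1}_u=\tfrac12(\nabla_u+\sqrt{-1}\,\nabla_{Ju})$ for real tangent vectors $u$. Let $f:X\to\mathbb R$ be a smooth function and let $V_f$ be its Hamiltonian vector field, defined by $\iota_{V_f}\omega=df$. In local holomorphic coordinates $(z^1,\dots,z^n)$ write $\bar y^j$ for $d\bar z^j$ regarded as a local frame of the anti-holomorphic cotangent bundle $\overline{T^*X}\subset T^*X_{\mathbb C}$, so that $\sum_j\frac{\partial f}{\partial\bar z^j}\,\bar y^j$ is a globally defined section of $\overline{T^*X}$. Then the following three conditions are equivalent: 1. $V_f$ preserves the complex structure, i.e. $\mathcal L_{V_f}J=0$; 2. $\nabla^{0,1}\Big(\sum_j\frac{\partial f}{\partial\bar z^j}\,\bar y^j\Big)=0$ on $X$; 3. the $(1,0)$-component $V_f^{1,0}=\tfrac12(V_f-\sqrt{-1}\,JV_f)$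 of $V_f$ is a holomorphic section of the holomorphic tangent bundle of $X$. -/

import Mathlib

open scoped Manifold ContDiff Topology TensorProduct

noncomputable section

namespace KahlerGeometry

/-- The model space `ℂⁿ` of complex manifolds of dimension `n`. -/
abbrev Cn (n : ℕ) : Type := EuclideanSpace ℂ (Fin n)

section Manifold

variable (n : ℕ) {X : Type*} [TopologicalSpace X] [ChartedSpace (Cn n) X]

/-- The real tangent space of `X` at `x`. In Mathlib it is the model space `ℂⁿ`, a tangent vector
being given by its components in the preferred chart at `x`. -/
abbrev RealTangent (x : X) : Type := TangentSpace 𝓘(ℝ, Cn n) x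

/-- The fibre at `x` of the holomorphic tangent bundle of the complex manifold `X`: again `ℂⁿ`,
the vector `v` standing for `∑ i, v i ∂/∂zⁱ` in the preferred holomorphic chart at `x`. -/
abbrev HolTangent (x : X) : Type := TangentSpace 𝓘(ℂ, Cn n) x

/-- A complex manifold is in particular a real analytic (hence smooth) manifold. -/
instance instIsManifoldReal [IsManifold 𝓘(ℂ, Cn n) ω X] : IsManifold 𝓘(ℝ, Cn n) ω X := by
  apply isManifold_of_contDiffOn
  intro e e' he he'
  have h := ((contDiffGroupoid ω 𝓘(ℂ, Cn n)).compatible he he')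
  have h2 := (contDiffGroupoid ω 𝓘(ℂ, Cn n)).mem_iff_of_eqOnSource
    (OpenPartialHomeomorph.eqOnSource_refl _) |>.1 h
  rw [contDiffGroupoid, mem_groupoid_of_pregroupoid] at h2
  have h3 := h2.1
  simp only [contDiffPregroupoid] at h3
  exact ContDiffOn.restrict_scalars ℝ h3

/-- The complex structure `J` of `X`, acting on the real tangent space at `x`: multiplication of
the components in a holomorphic chart by `√-1`. -/
def J (x : X) : RealTangent n x →L[ℝ] RealTangent n x :=
  (Complex.I • ContinuousLinearMap.id ℝ (Cn n) : Cn n →L[ℝ] Cn n)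

/-- The differential at `z` of the inverse of a chart `φ`: it sends a vector of `ℂⁿ` to the tangent
vector of `X` that has it as components in the chart `φ`. -/
def dChartSymm (φ : OpenPartialHomeomorph X (Cn n)) (z : Cn n) :
    Cn n →L[ℝ] RealTangent n (φ.symm z) :=
  mfderiv 𝓘(ℝ, Cn n) 𝓘(ℝ, Cn n) φ.symm z

/-- The expression in the chart `φ` of a field of real bilinear forms. -/
def bilinInChart (b : ∀ x : X, RealTangent n x →L[ℝ] RealTangent n x →L[ℝ] ℝ)
    (φ : OpenPartialHomeomorph X (Cn n)) (z : Cn n) : Cn n →L[ℝ] Cn n →L[ℝ] ℝ :=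
  ContinuousLinearMap.bilinearComp (E := Cn n) (F := Cn n) (b (φ.symm z))
    (dChartSymm n φ z) (dChartSymm n φ z)

/-- The expression in the chart `φ` of a complex-valued 1-form. -/
def oneFormInChart (α : ∀ x : X, RealTangent n x →L[ℝ] ℂ)
    (φ : OpenPartialHomeomorph X (Cn n)) (z : Cn n) : Cn n →L[ℝ] ℂ :=
  (α (φ.symm z)).comp (dChartSymm n φ z)

variable (X) in
/-- A Kähler form on a complex manifold `X`: a smooth closed real 2-form of type `(1,1)`
(equivalently, `J`-invariant) with `ω(v, J v) > 0` for `v ≠ 0`. -/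
structure KahlerForm where
  form : ∀ x : X, RealTangent n x →L[ℝ] RealTangent n x →L[ℝ] ℝ
  alternating : ∀ (x : X) (v : RealTangent n x), form x v v = 0
  smooth : ∀ φ ∈ atlas (Cn n) X, ContDiffOn ℝ ∞ (bilinInChart n form φ) φ.target
  /-- `dω (u, v, w) = 0`, evaluated on constant vector fields in a chart. -/
  closed : ∀ φ ∈ atlas (Cn n) X, ∀ z ∈ φ.target, ∀ u v w : Cn n,
    fderiv ℝ (bilinInChart n form φ) z u v w + fderiv ℝ (bilinInChart n form φ) z v w u
      + fderiv ℝ (bilinInChart n form φ) z w u v = 0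
  invariant : ∀ (x : X) (u v : RealTangent n x), form x (J n x u) (J n x v) = form x u v
  positive : ∀ (x : X) (v : RealTangent n x), v ≠ 0 → 0 < form x v (J n x v)

end Manifold

theorem exists_musical {n : ℕ} (B : Cn n →L[ℝ] Cn n →L[ℝ] ℝ) (hB : ∀ v, B v = 0 → v = 0)
    (α : Cn n →L[ℝ] ℝ) : ∃ v, B v = α := by
  let e : (Cn n →ₗ[ℝ] ℝ) ≃ₗ[ℝ] (Cn n →L[ℝ] ℝ) := LinearMap.toContinuousLinearMap
  have hfin : Module.finrank ℝ (Cn n) = Module.finrank ℝ (Cn n →L[ℝ] ℝ) := by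
    rw [← e.finrank_eq]
    exact (Subspace.dual_finrank_eq (K := ℝ) (V := Cn n)).symm
  have : Module.Finite ℝ (Cn n →L[ℝ] ℝ) := Module.Finite.equiv e
  have hinj : Function.Injective (B : Cn n →ₗ[ℝ] (Cn n →L[ℝ] ℝ)) := by
    rw [injective_iff_map_eq_zero]
    exact hB
  exact ((LinearMap.injective_iff_surjective_of_finrank_eq_finrank hfin).1 hinj) α

section Kahler

variable {n : ℕ} {X : Type*} [TopologicalSpace X] [ChartedSpace (Cn n) X]

/-- The differential of a real function. -/
def differential (f : X → ℝ) (x : X) : RealTangent n x →L[ℝ] ℝ :=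
  mfderiv 𝓘(ℝ, Cn n) 𝓘(ℝ, ℝ) f x

namespace KahlerForm

variable (K : KahlerForm n X)

theorem nondegenerate (x : X) (v : RealTangent n x) (h : K.form x v = 0) : v = 0 := by
  by_contra hv
  have := K.positive x v hv
  rw [h] at this
  exact lt_irrefl _ this

theorem exists_hamiltonian (f : X → ℝ) (x : X) :
    ∃ V : RealTangent n x, K.form x V = differential f x :=
  exists_musical (K.form x) (K.nondegenerate x) (differential f x)

/-- The Hamiltonian vector field `V_f` of `f`: the unique vector field with `ι_{V_f} ω = df`. -/
def hamiltonian (f : X → ℝ) (x : X) : RealTangent n x := (K.exists_hamiltonian f x).choose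

theorem form_hamiltonian (f : X → ℝ) (x : X) : K.form x (K.hamiltonian f x) = differential f x :=
  (K.exists_hamiltonian f x).choose_spec

/-- The Riemannian metric `g(u, v) = ω(u, J v)` of the Kähler manifold. -/
def metric (x : X) : RealTangent n x →L[ℝ] RealTangent n x →L[ℝ] ℝ :=
  (ContinuousLinearMap.bilinearComp (E := Cn n) (F := Cn n) (K.form x)
    (ContinuousLinearMap.id ℝ (Cn n)) (J n x : Cn n →L[ℝ] Cn n) :
      Cn n →L[ℝ] Cn n →L[ℝ] ℝ)

theorem metric_apply (x : X) (u v : RealTangent n x) : K.metric x u v = K.form x u (J n x v) := rfl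

theorem metric_nondegenerate (x : X) (v : RealTangent n x) (h : K.metric x v = 0) : v = 0 := by
  by_contra hv
  have := K.positive x v hv
  rw [← K.metric_apply, h] at this
  exact lt_irrefl _ this

/-- The first derivative at `x` of the expression of the metric in the preferred chart at `x`. -/
def metricDeriv (x : X) : Cn n →L[ℝ] Cn n →L[ℝ] Cn n →L[ℝ] ℝ :=
  fderiv ℝ (bilinInChart n K.metric (chartAt (Cn n) x)) (chartAt (Cn n) x x)

/-- The Christoffel symbols of the first kind at `x`, as a functional of the last argument:
`w ↦ (D_u g(v, w) + D_v g(u, w) - D_w g(u, v)) / 2`. -/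
def christoffelFirst (x : X) (u v : Cn n) : Cn n →L[ℝ] ℝ :=
  (1 / 2 : ℝ) • (K.metricDeriv x u v + K.metricDeriv x v u
    - ((K.metricDeriv x).flip u).flip v)

theorem christoffelFirst_apply (x : X) (u v w : Cn n) :
    K.christoffelFirst x u v w =
      (1 / 2 : ℝ) * (K.metricDeriv x u v w + K.metricDeriv x v u w - K.metricDeriv x w u v) := rfl

theorem exists_christoffel (x : X) (u v : RealTangent n x) :
    ∃ Γ : RealTangent n x, K.metric x Γ = K.christoffelFirst x u v :=
  exists_musical (K.metric x) (K.metric_nondegenerate x) (K.christoffelFirst x u v)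

/-- The Christoffel symbols `Γ(u, v)` at `x` of the Levi-Civita connection of `g`, in the preferred
chart at `x`: `g(Γ(u, v), w) = (D_u g(v, w) + D_v g(u, w) - D_w g(u, v)) / 2`. -/
def christoffel (x : X) (u v : RealTangent n x) : RealTangent n x :=
  (K.exists_christoffel x u v).choose

theorem metric_christoffel (x : X) (u v : RealTangent n x) :
    K.metric x (K.christoffel x u v) = K.christoffelFirst x u v :=
  (K.exists_christoffel x u v).choose_spec

/-- The Levi-Civita connection on complex-valued 1-forms (that is, on sections of the complexified
cotangent bundle): `(∇_u α)(v) = (D_u α)(v) - α(Γ(u, v))` in the preferred chart at `x`. -/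
def nabla (α : ∀ x : X, RealTangent n x →L[ℝ] ℂ) (x : X) (u v : RealTangent n x) : ℂ :=
  fderiv ℝ (oneFormInChart n α (chartAt (Cn n) x)) (chartAt (Cn n) x x) u v
    - α x (K.christoffel x u v)

/-- The `(0,1)`-part `∇^{0,1}` of the connection with respect to the direction of
differentiation: `∇^{0,1}_u = (∇_u + √-1 ∇_{J u}) / 2`. -/
def nabla01 (α : ∀ x : X, RealTangent n x →L[ℝ] ℂ) (x : X) (u v : RealTangent n x) : ℂ :=
  (1 / 2 : ℂ) * (K.nabla α x u v + Complex.I * K.nabla α x (J n x u) v)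

end KahlerForm

/-- The coordinate vector `∂/∂xʲ` at `x`, where `zʲ = xʲ + √-1 yʲ`; then `∂/∂yʲ = J ∂/∂xʲ`. -/
def coordVector (x : X) (j : Fin n) : RealTangent n x :=
  (EuclideanSpace.single j (1 : ℂ) : Cn n)

/-- The Wirtinger derivative `∂f/∂z̄ʲ = (∂f/∂xʲ + √-1 ∂f/∂yʲ) / 2` at `x`. -/
def wirtingerBar (f : X → ℝ) (x : X) (j : Fin n) : ℂ :=
  (1 / 2 : ℂ) * ((differential f x (coordVector x j) : ℂ)
    + Complex.I * (differential f x (J n x (coordVector x j)) : ℂ))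

/-- The covector `ȳʲ` at `x`, i.e. the fibre coordinate `dz̄ʲ` of the anti-holomorphic cotangent
bundle, which sits in the complexified cotangent bundle. -/
def yBar (x : X) (j : Fin n) : RealTangent n x →L[ℝ] ℂ :=
  (Complex.conjCLE : ℂ →L[ℝ] ℂ).comp
    ((EuclideanSpace.proj j : Cn n →L[ℂ] ℂ).restrictScalars ℝ)

/-- The section `(∂f/∂z̄ʲ) ȳʲ` (summed over `j`) of the anti-holomorphic cotangent bundle. -/
def dbarSection (f : X → ℝ) (x : X) : RealTangent n x →L[ℝ] ℂ :=
  ∑ j : Fin n, wirtingerBar f x j • yBar x j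

/-- The Lie derivative `(L_V J)(W) = [V, J W] - J [V, W]` of the complex structure. -/
def lieDerivJ (V W : ∀ x : X, RealTangent n x) (x : X) : RealTangent n x :=
  VectorField.mlieBracket 𝓘(ℝ, Cn n) V (fun y => J n y (W y)) x
    - J n x (VectorField.mlieBracket 𝓘(ℝ, Cn n) V W x)

section

variable [IsManifold 𝓘(ℂ, Cn n) ω X]

/-- `V` preserves the complex structure: `L_V J = 0`, tested on all local smooth vector fields. -/
def PreservesComplexStructure (V : ∀ x : X, RealTangent n x) : Prop :=
  ∀ U : Set X, IsOpen U → ∀ W : ∀ x : X, RealTangent n x,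
    ContMDiffOn 𝓘(ℝ, Cn n) (𝓘(ℝ, Cn n).prod 𝓘(ℝ, Cn n)) ∞
      (fun x => (⟨x, W x⟩ : TangentBundle 𝓘(ℝ, Cn n) X)) U →
    ∀ x ∈ U, lieDerivJ V W x = 0

end

/-- The `(1,0)`-component `V^{1,0} = (V - √-1 J V) / 2` of a real vector field, a section of the
complexified tangent bundle. -/
def part10 (V : ∀ x : X, RealTangent n x) (x : X) : ℂ ⊗[ℝ] RealTangent n x :=
  (1 / 2 : ℂ) • ((1 : ℂ) ⊗ₜ[ℝ] V x - Complex.I ⊗ₜ[ℝ] J n x (V x))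

/-- A complexified tangent vector is of type `(1,0)` if `J` acts on it as `√-1`. -/
def IsType10 (x : X) (ξ : ℂ ⊗[ℝ] RealTangent n x) : Prop :=
  LinearMap.baseChange ℂ (J n x : RealTangent n x →ₗ[ℝ] RealTangent n x) ξ = Complex.I • ξ

/-- The projection from the complexified tangent space to the holomorphic tangent space along the
`(0,1)`-vectors, `c ⊗ v ↦ c v`: it sends `∂/∂zⁱ = (∂/∂xⁱ - √-1 ∂/∂yⁱ) / 2` to the `i`-th basis
vector and `∂/∂z̄ⁱ` to `0`. -/
def toHolTangent (x : X) : ℂ ⊗[ℝ] RealTangent n x →ₗ[ℝ] HolTangent n x :=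
  TensorProduct.lift ((LinearMap.lsmul ℂ (Cn n)).restrictScalars₁₂ ℝ ℝ : ℂ →ₗ[ℝ] Cn n →ₗ[ℝ] Cn n)

section

variable [IsManifold 𝓘(ℂ, Cn n) ω X]

/-- A complex vector field is a holomorphic vector field of type `(1,0)`: its values have
type `(1,0)` and it is holomorphic as a section of the holomorphic tangent bundle. -/
def IsHolomorphic10 (Z : ∀ x : X, ℂ ⊗[ℝ] RealTangent n x) : Prop :=
  (∀ x, IsType10 x (Z x)) ∧
    MDifferentiable 𝓘(ℂ, Cn n) (𝓘(ℂ, Cn n).prod 𝓘(ℂ, Cn n))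
      (fun x => (⟨x, toHolTangent x (Z x)⟩ : TangentBundle 𝓘(ℂ, Cn n) X))

end

end Kahler

end KahlerGeometry

end

/-!
Fix a point `x` and work in the preferred holomorphic chart at `x`. All three conditions say that
the derivative `D` at `x` of the chart expression of `V = V_f` is complex linear, that is
`D (J u) = J (D u)` for all `u`.

* Condition 1: in a holomorphic chart `J` is constant, so the terms of
  `(L_V J) W = [V, J W] - J [V, W]` that differentiate `W` cancel, and
  `(L_V J) W = J (D W) - D (J W)` (`lieDerivJ_eq`). Every tangent vector at `x` is the value of a
  smooth local field `W` (`preservesComplexStructure_iff`).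
* Condition 2: `∂̄f = (df + √-1 df ∘ J) / 2`, and `df = ω(V, ·)`. Hence `∇_u ∂̄f` involves `D`, the
  derivatives of `ω` and the Christoffel symbols, and the latter are given by derivatives of `ω`
  because `g = ω(·, J ·)`. Closedness of `ω` brings all derivatives of `ω` into the directions `V`
  and `J V` (`KahlerForm.nabla_dbarSection`); there they cancel in `∇^{0,1}` because `ω` is
  `J`-invariant, which leaves `4 (∇^{0,1}_u ∂̄f)(v) = ω(E u, J v) - √-1 ω(E u, v)` with
  `E u = J (D u) - D (J u)` (`KahlerForm.nabla01_dbarSection`). Nondegeneracy of `ω` gives `E = 0`.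
* Condition 3: `V^{1,0}` corresponds to `V` under the identification of the holomorphic with the
  real tangent bundle (`toHolTangent_part10`), and a real differentiable map is holomorphic
  exactly when its derivative is complex linear (`isHolomorphic10_hamiltonian_iff`).

Since a tangent vector of `X` at `y` is stored by its components in the preferred chart at `y`,
chart expressions near `x` involve the changes of components `compTo` and `compFrom`; they are
complex linear because the charts are holomorphic.
-/

noncomputable section

namespace KahlerGeometry

variable {n : ℕ} {X : Type*} [TopologicalSpace X] [ChartedSpace (Cn n) X]

/-! ### Changes of components of tangent vectors -/

section Coordinates

variable [IsManifold 𝓘(ℂ, Cn n) ω X]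

/-- Holomorphic charts: the real coordinate changes of tangent vectors are complex linear. -/
theorem tangentCoordChange_real_eq (x y z : X) (hx : z ∈ (chartAt (Cn n) x).source)
    (hy : z ∈ (chartAt (Cn n) y).source) :
    (tangentCoordChange 𝓘(ℝ, Cn n) x y z : Cn n →L[ℝ] Cn n) =
      (tangentCoordChange 𝓘(ℂ, Cn n) x y z : Cn n →L[ℂ] Cn n).restrictScalars ℝ := by
  have hC := hasFDerivWithinAt_tangentCoordChange (I := 𝓘(ℂ, Cn n)) (x := x) (y := y) (z := z)
    (by simpa using ⟨hx, hy⟩)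
  have hR := hasFDerivWithinAt_tangentCoordChange (I := 𝓘(ℝ, Cn n)) (x := x) (y := y) (z := z)
    (by simpa using ⟨hx, hy⟩)
  have hC' := hC.restrictScalars ℝ
  simp only [modelWithCornersSelf_coe, Set.range_id, hasFDerivWithinAt_univ] at hC' hR
  exact hR.unique hC'

variable (n) in
/-- The change of components of tangent vectors at `y`, from the preferred chart at `y` to the
preferred chart at `x`. -/
def compTo (x y : X) : Cn n →L[ℝ] Cn n := tangentCoordChange 𝓘(ℝ, Cn n) y x y

variable (n) in
/-- The change of components of tangent vectors at `y`, from the preferred chart at `x` to the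
preferred chart at `y`. For `y` in the domain of the chart at `x` it is inverse to
`compTo n x y`. -/
def compFrom (x y : X) : Cn n →L[ℝ] Cn n := tangentCoordChange 𝓘(ℝ, Cn n) x y y

variable {x y : X}

theorem compTo_compFrom (hy : y ∈ (chartAt (Cn n) x).source) (v : Cn n) :
    compTo n x y (compFrom n x y v) = v := by
  have h := tangentCoordChange_comp (I := 𝓘(ℝ, Cn n)) (w := x) (x := y) (y := x) (z := y) (v := v)
    (by simpa using hy)
  rw [tangentCoordChange_self (by simpa using hy)] at h
  exact h

theorem compFrom_compTo (hy : y ∈ (chartAt (Cn n) x).source) (v : Cn n) :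
    compFrom n x y (compTo n x y v) = v := by
  have h := tangentCoordChange_comp (I := 𝓘(ℝ, Cn n)) (w := y) (x := x) (y := y) (z := y) (v := v)
    (by simpa using hy)
  rw [tangentCoordChange_self (by simp)] at h
  exact h

theorem compTo_I_smul (hy : y ∈ (chartAt (Cn n) x).source) (v : Cn n) :
    compTo n x y (Complex.I • v) = Complex.I • compTo n x y v := by
  rw [compTo, tangentCoordChange_real_eq y x y (by simp) hy]
  exact map_smul (tangentCoordChange 𝓘(ℂ, Cn n) y x y : Cn n →L[ℂ] Cn n) _ _

theorem compFrom_I_smul (hy : y ∈ (chartAt (Cn n) x).source) (v : Cn n) :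
    compFrom n x y (Complex.I • v) = Complex.I • compFrom n x y v := by
  rw [compFrom, tangentCoordChange_real_eq x y y hy (by simp)]
  exact map_smul (tangentCoordChange 𝓘(ℂ, Cn n) x y y : Cn n →L[ℂ] Cn n) _ _

theorem compFrom_self (x : X) (v : Cn n) : compFrom n x x v = v :=
  tangentCoordChange_self (by simp)

theorem compTo_self (x : X) (v : Cn n) : compTo n x x v = v :=
  tangentCoordChange_self (by simp)

/-- A tangent vector at `y` is stored by its components in the preferred chart at `y`, so the
differential of the inverse of the chart at `x` is a change of components. -/
theorem dChartSymm_chartAt (x : X) {z : Cn n} (hz : z ∈ (chartAt (Cn n) x).target) :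
    (dChartSymm n (chartAt (Cn n) x) z : Cn n →L[ℝ] Cn n) =
      compFrom n x ((chartAt (Cn n) x).symm z) := by
  have hd : MDifferentiableAt 𝓘(ℝ, Cn n) 𝓘(ℝ, Cn n) (chartAt (Cn n) x).symm z :=
    mdifferentiableAt_atlas_symm (chart_mem_atlas _ x) hz
  have h1 : dChartSymm n (chartAt (Cn n) x) z = _ := hd.mfderiv
  rw [compFrom, tangentCoordChange_def]
  simp only [h1]
  simp [hz, writtenInExtChartAt]
  rfl

end Coordinates

/-! ### Expressions in the preferred chart -/

section ChartExpressions

/-- `∂̄f` is `(df + √-1 df ∘ J) / 2`, an expression that does not mention coordinates. -/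
theorem dbarSection_apply (f : X → ℝ) (x : X) (v : Cn n) :
    dbarSection f x v = (1 / 2 : ℂ) * ((differential f x v : ℂ)
      + Complex.I * (differential f x (Complex.I • v : Cn n) : ℂ)) := by
  let D : Cn n →L[ℝ] ℝ := differential f x
  let e : Fin n → Cn n := fun j => EuclideanSpace.single j (1 : ℂ)
  -- the real coordinates of `v`, with respect to `∂/∂xʲ` and `∂/∂yʲ = J ∂/∂xʲ`
  have hv : v = ∑ j, ((v j).re • e j + (v j).im • (Complex.I • e j)) := by
    ext k
    simp only [e, WithLp.ofLp_sum, Finset.sum_apply, PiLp.add_apply, PiLp.smul_apply,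
      PiLp.single_apply]
    simp only [smul_eq_mul, mul_ite, mul_one, mul_zero, smul_ite, smul_zero, ← ite_add_zero]
    simp
  have h1 : D v = ∑ j, ((v j).re * D (e j) + (v j).im * D (Complex.I • e j)) := by
    conv_lhs => rw [hv]
    simp only [map_sum, map_add, map_smul, smul_eq_mul]
  have h2 : D (Complex.I • v) =
      ∑ j, ((v j).re * D (Complex.I • e j) - (v j).im * D (e j)) := by
    conv_lhs => rw [hv]
    simp only [Finset.smul_sum, smul_add, map_sum, map_add]
    refine Finset.sum_congr rfl fun j _ => ?_
    rw [smul_comm Complex.I (v j).re, smul_comm Complex.I (v j).im, smul_smul Complex.I,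
      Complex.I_mul_I, neg_one_smul, D.map_smul, D.map_smul, D.map_neg]
    simp only [smul_eq_mul]
    ring
  have h0 : dbarSection f x v = ∑ j, (1 / 2 : ℂ) * ((D (e j) : ℂ)
      + Complex.I * (D (Complex.I • e j) : ℂ)) * (starRingEnd ℂ) (v j) := by
    have : dbarSection f x v = ∑ j, wirtingerBar f x j * (yBar x j : Cn n →L[ℝ] ℂ) v := by
      exact _root_.sum_apply (F := Cn n →L[ℝ] ℂ) Finset.univ
        (fun j => wirtingerBar f x j • (yBar x j : Cn n →L[ℝ] ℂ)) v
    rw [this]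
    rfl
  rw [h0]
  change _ = (1 / 2 : ℂ) * ((D v : ℂ) + Complex.I * (D (Complex.I • v) : ℂ))
  rw [h1, h2]
  push_cast
  rw [Finset.mul_sum, ← Finset.sum_add_distrib, Finset.mul_sum]
  refine Finset.sum_congr rfl fun j _ => ?_
  have hc : (starRingEnd ℂ) (v j) = (v j).re - Complex.I * (v j).im := by
    apply Complex.ext <;> simp
  rw [hc]
  linear_combination (-1 / 2 : ℂ) * (v j).im * D (Complex.I • e j) * Complex.I_sq

variable [IsManifold 𝓘(ℂ, Cn n) ω X] {x : X} {z : Cn n}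

/-- The expression of a vector field in the preferred chart at `x`. -/
def fieldInChart (V : ∀ y : X, RealTangent n y) (x : X) (z : Cn n) : Cn n :=
  compTo n x ((chartAt (Cn n) x).symm z) (V ((chartAt (Cn n) x).symm z))

theorem fieldInChart_self (V : ∀ y : X, RealTangent n y) (x : X) :
    fieldInChart V x (chartAt (Cn n) x x) = V x := by
  rw [fieldInChart, (chartAt (Cn n) x).left_inv (mem_chart_source _ x)]
  exact compTo_self x _

theorem compFrom_fieldInChart (V : ∀ y : X, RealTangent n y)
    (hz : z ∈ (chartAt (Cn n) x).target) :
    compFrom n x ((chartAt (Cn n) x).symm z) (fieldInChart V x z) =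
      V ((chartAt (Cn n) x).symm z) :=
  compFrom_compTo ((chartAt (Cn n) x).map_target hz) _

theorem bilinInChart_apply (b : ∀ x : X, RealTangent n x →L[ℝ] RealTangent n x →L[ℝ] ℝ)
    (hz : z ∈ (chartAt (Cn n) x).target) (u v : Cn n) :
    bilinInChart n b (chartAt (Cn n) x) z u v =
      b ((chartAt (Cn n) x).symm z) (compFrom n x ((chartAt (Cn n) x).symm z) u)
        (compFrom n x ((chartAt (Cn n) x).symm z) v) := by
  rw [← dChartSymm_chartAt x hz]
  rfl

theorem oneFormInChart_apply (α : ∀ x : X, RealTangent n x →L[ℝ] ℂ)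
    (hz : z ∈ (chartAt (Cn n) x).target) (v : Cn n) :
    oneFormInChart n α (chartAt (Cn n) x) z v =
      α ((chartAt (Cn n) x).symm z) (compFrom n x ((chartAt (Cn n) x).symm z) v) := by
  rw [← dChartSymm_chartAt x hz]
  rfl

/-- The chart expression of `df` is the derivative of the chart expression of `f`. -/
theorem differential_compFrom {f : X → ℝ}
    (hf : MDifferentiableAt 𝓘(ℝ, Cn n) 𝓘(ℝ, ℝ) f ((chartAt (Cn n) x).symm z))
    (hz : z ∈ (chartAt (Cn n) x).target) (v : Cn n) :
    differential f ((chartAt (Cn n) x).symm z) (compFrom n x ((chartAt (Cn n) x).symm z) v) =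
      fderiv ℝ (f ∘ (chartAt (Cn n) x).symm) z v := by
  have hd : MDifferentiableAt 𝓘(ℝ, Cn n) 𝓘(ℝ, Cn n) (chartAt (Cn n) x).symm z :=
    mdifferentiableAt_atlas_symm (chart_mem_atlas _ x) hz
  rw [← dChartSymm_chartAt x hz, ← mfderiv_eq_fderiv, mfderiv_comp z hf hd]
  rfl

end ChartExpressions

/-! ### The Kähler form and its Hamiltonian fields in a chart -/

section KahlerChart

variable {x : X} {z : Cn n}

theorem eventually_mem_chartAt_target (x : X) :
    ∀ᶠ z in 𝓝 (chartAt (Cn n) x x), z ∈ (chartAt (Cn n) x).target :=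
  (chartAt (Cn n) x).open_target.mem_nhds (mem_chart_target _ x)

namespace KahlerForm

variable (K : KahlerForm n X)

theorem differentiableAt_formInChart (hz : z ∈ (chartAt (Cn n) x).target) :
    DifferentiableAt ℝ (bilinInChart n K.form (chartAt (Cn n) x)) z :=
  ((K.smooth _ (chart_mem_atlas _ x)).contDiffAt
    ((chartAt (Cn n) x).open_target.mem_nhds hz)).differentiableAt (by simp)

/-- The first derivative at `x` of the Kähler form in the preferred chart at `x`. -/
def formDeriv (x : X) : Cn n →L[ℝ] Cn n →L[ℝ] Cn n →L[ℝ] ℝ :=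
  fderiv ℝ (bilinInChart n K.form (chartAt (Cn n) x)) (chartAt (Cn n) x x)

theorem hasFDerivAt_formInChart (x : X) :
    HasFDerivAt (bilinInChart n K.form (chartAt (Cn n) x)) (K.formDeriv x)
      (chartAt (Cn n) x x) :=
  (K.differentiableAt_formInChart (mem_chart_target _ x)).hasFDerivAt

theorem hasFDerivAt_formInChart_apply (x : X) (v w : Cn n) :
    HasFDerivAt (fun z => bilinInChart n K.form (chartAt (Cn n) x) z v w)
      (((K.formDeriv x).flip v).flip w) (chartAt (Cn n) x x) := by
  have h1 := ((K.hasFDerivAt_formInChart x).clm_apply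
    (hasFDerivAt_const v (chartAt (Cn n) x x))).clm_apply
    (hasFDerivAt_const w (chartAt (Cn n) x x))
  refine h1.congr_fderiv ?_
  ext u
  simp

/-- `dω = 0`. -/
theorem formDeriv_cyclic (x : X) (u v w : Cn n) :
    K.formDeriv x u v w + K.formDeriv x v w u + K.formDeriv x w u v = 0 :=
  K.closed _ (chart_mem_atlas _ x) _ (mem_chart_target _ x) u v w

variable [IsManifold 𝓘(ℂ, Cn n) ω X]

theorem formInChart_I_smul (hz : z ∈ (chartAt (Cn n) x).target) (u v : Cn n) :
    bilinInChart n K.form (chartAt (Cn n) x) z (Complex.I • u) (Complex.I • v) =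
      bilinInChart n K.form (chartAt (Cn n) x) z u v := by
  have hy := (chartAt (Cn n) x).map_target hz
  rw [bilinInChart_apply _ hz, bilinInChart_apply _ hz, compFrom_I_smul hy, compFrom_I_smul hy]
  exact K.invariant _ _ _

theorem formInChart_self (hz : z ∈ (chartAt (Cn n) x).target) (v : Cn n) :
    bilinInChart n K.form (chartAt (Cn n) x) z v v = 0 := by
  rw [bilinInChart_apply _ hz]
  exact K.alternating _ _

theorem metricInChart_apply (hz : z ∈ (chartAt (Cn n) x).target) (u v : Cn n) :
    bilinInChart n K.metric (chartAt (Cn n) x) z u v =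
      bilinInChart n K.form (chartAt (Cn n) x) z u (Complex.I • v) := by
  rw [bilinInChart_apply _ hz, bilinInChart_apply _ hz,
    compFrom_I_smul ((chartAt (Cn n) x).map_target hz)]
  rfl

theorem formInChart_nondegenerate (hz : z ∈ (chartAt (Cn n) x).target) (v : Cn n)
    (h : bilinInChart n K.form (chartAt (Cn n) x) z v = 0) : v = 0 := by
  have hy := (chartAt (Cn n) x).map_target hz
  have h0 : compFrom n x ((chartAt (Cn n) x).symm z) v = 0 := by
    by_contra hv
    have hp := K.positive ((chartAt (Cn n) x).symm z) _ hv
    have h1 := congrArg (fun a : Cn n →L[ℝ] ℝ => a (Complex.I • v)) h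
    simp only [bilinInChart_apply _ hz, compFrom_I_smul hy] at h1
    exact hp.ne' h1
  rw [← compTo_compFrom hy v, h0, map_zero]

/-- In its own preferred chart, the components of a tangent vector at `x` are the vector itself. -/
theorem formInChart_self_point (u v : Cn n) :
    bilinInChart n K.form (chartAt (Cn n) x) (chartAt (Cn n) x x) u v = K.form x u v := by
  rw [bilinInChart_apply _ (mem_chart_target _ x)]
  have h : ∀ y, y = x → K.form y (compFrom n x y u) (compFrom n x y v) = K.form x u v := by
    rintro _ rfl
    rw [compFrom_self, compFrom_self]
  exact h _ ((chartAt (Cn n) x).left_inv (mem_chart_source _ x))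

/-- The chart expression of `ι_{V_f} ω = df`. -/
theorem formInChart_hamiltonian {f : X → ℝ} (hf : MDifferentiable 𝓘(ℝ, Cn n) 𝓘(ℝ, ℝ) f)
    (hz : z ∈ (chartAt (Cn n) x).target) :
    bilinInChart n K.form (chartAt (Cn n) x) z (fieldInChart (K.hamiltonian f) x z) =
      fderiv ℝ (f ∘ (chartAt (Cn n) x).symm) z := by
  ext v
  rw [bilinInChart_apply _ hz, compFrom_fieldInChart _ hz,
    ← differential_compFrom (hf _) hz, ← K.form_hamiltonian]

/-- The Hamiltonian vector field is differentiable, being the solution of a linear equation with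
differentiable coefficients. -/
theorem differentiableAt_hamiltonianInChart {f : X → ℝ}
    (hf : ContMDiff 𝓘(ℝ, Cn n) 𝓘(ℝ, ℝ) ∞ f) (hz : z ∈ (chartAt (Cn n) x).target) :
    DifferentiableAt ℝ (fieldInChart (K.hamiltonian f) x) z := by
  let b := bilinInChart n K.form (chartAt (Cn n) x)
  have hmem : ∀ᶠ w in 𝓝 z, w ∈ (chartAt (Cn n) x).target :=
    (chartAt (Cn n) x).open_target.mem_nhds hz
  have hinv : ∀ w ∈ (chartAt (Cn n) x).target, (b w).IsInvertible := by
    intro w hw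
    have hinj : Function.Injective (b w) :=
      (injective_iff_map_eq_zero (b w)).2 (K.formInChart_nondegenerate hw)
    let e : Cn n ≃ₗ[ℝ] (Cn n →L[ℝ] ℝ) := LinearEquiv.ofBijective (b w : Cn n →ₗ[ℝ] Cn n →L[ℝ] ℝ)
      ⟨hinj, exists_musical (b w) (K.formInChart_nondegenerate hw)⟩
    exact ⟨e.toContinuousLinearEquiv, by ext; rfl⟩
  have hfd : DifferentiableAt ℝ (fderiv ℝ (f ∘ (chartAt (Cn n) x).symm)) z := by
    have h1 : ContMDiffAt 𝓘(ℝ, Cn n) 𝓘(ℝ, ℝ) ∞ (f ∘ (chartAt (Cn n) x).symm) z :=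
      hf.contMDiffAt.comp z ((contMDiffOn_chart_symm (x := x)).contMDiffAt hmem)
    exact (h1.contDiffAt.fderiv_right (m := 1) (by norm_cast)).differentiableAt (by simp)
  have hbinv : DifferentiableAt ℝ (fun w => (b w).inverse) z :=
    ((hinv z hz).contDiffAt_map_inverse (n := 1)).differentiableAt (by simp) |>.comp z
      (K.differentiableAt_formInChart hz)
  refine (hbinv.clm_apply hfd).congr_of_eventuallyEq ?_
  filter_upwards [hmem] with w hw
  rw [← K.formInChart_hamiltonian (hf.mdifferentiable (by simp)) hw]
  exact ((hinv w hw).inverse_apply_self _).symm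

theorem formDeriv_I_smul (x : X) (u v w : Cn n) :
    K.formDeriv x u (Complex.I • v) (Complex.I • w) = K.formDeriv x u v w := by
  have h := (K.hasFDerivAt_formInChart_apply x (Complex.I • v) (Complex.I • w))
    |>.congr_of_eventuallyEq ((eventually_mem_chartAt_target x).mono fun z hz =>
      (K.formInChart_I_smul hz v w).symm)
  exact congrArg (fun a : Cn n →L[ℝ] ℝ => a u)
    (h.unique (K.hasFDerivAt_formInChart_apply x v w))

theorem formDeriv_self (x : X) (u v : Cn n) : K.formDeriv x u v v = 0 := by
  have h := (K.hasFDerivAt_formInChart_apply x v v).congr_of_eventuallyEq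
    ((eventually_mem_chartAt_target x).mono fun z hz => (K.formInChart_self hz v).symm)
  exact congrArg (fun a : Cn n →L[ℝ] ℝ => a u) (h.unique (hasFDerivAt_const 0 _))

theorem formDeriv_swap (x : X) (u v w : Cn n) : K.formDeriv x u v w = -K.formDeriv x u w v := by
  have h := K.formDeriv_self x u (v + w)
  simp only [map_add, add_apply, K.formDeriv_self] at h
  linarith

/-- `g(v, w) = ω(v, J w)` with `J` constant in a holomorphic chart. -/
theorem metricDeriv_eq (x : X) (u v w : Cn n) :
    K.metricDeriv x u v w = K.formDeriv x u v (Complex.I • w) := by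
  -- composition with `J` in the second argument, as a continuous linear map on bilinear forms
  obtain ⟨P, hP⟩ : ∃ P : (Cn n →L[ℝ] Cn n →L[ℝ] ℝ) →L[ℝ] (Cn n →L[ℝ] Cn n →L[ℝ] ℝ),
      ∀ b u v, P b u v = b u (Complex.I • v) :=
    ⟨ContinuousLinearMap.compL ℝ (Cn n) (Cn n →L[ℝ] ℝ) (Cn n →L[ℝ] ℝ)
      ((ContinuousLinearMap.compL ℝ (Cn n) (Cn n) ℝ).flip
        (Complex.I • ContinuousLinearMap.id ℝ (Cn n))), fun _ _ _ => rfl⟩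
  have h1 := HasFDerivAt.comp (𝕜 := ℝ) (F := Cn n →L[ℝ] Cn n →L[ℝ] ℝ)
    (G := Cn n →L[ℝ] Cn n →L[ℝ] ℝ) (chartAt (Cn n) x x) P.hasFDerivAt
    (K.hasFDerivAt_formInChart x)
  have h2 : HasFDerivAt (bilinInChart n K.metric (chartAt (Cn n) x)) (P.comp (K.formDeriv x))
      (chartAt (Cn n) x x) := by
    refine h1.congr_of_eventuallyEq ((eventually_mem_chartAt_target x).mono fun z hz => ?_)
    ext u v
    exact (K.metricInChart_apply hz u v).trans (hP _ _ _).symm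
  rw [metricDeriv, h2.fderiv]
  exact hP _ _ _

end KahlerForm

end KahlerChart

/-! ### The Levi-Civita connection on `∂̄f` -/

section Connection

variable [IsManifold 𝓘(ℂ, Cn n) ω X]

namespace KahlerForm

variable (K : KahlerForm n X)

/-- The Kähler form at `x` in the preferred chart at `x`, a bilinear form on `ℂⁿ`. -/
def formAt (x : X) : Cn n →L[ℝ] Cn n →L[ℝ] ℝ :=
  bilinInChart n K.form (chartAt (Cn n) x) (chartAt (Cn n) x x)

theorem formAt_I_smul (x : X) (u v : Cn n) :
    K.formAt x (Complex.I • u) (Complex.I • v) = K.formAt x u v :=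
  K.formInChart_I_smul (mem_chart_target _ x) u v

theorem formAt_swap (x : X) (u v : Cn n) : K.formAt x u v = -K.formAt x v u := by
  have hb : ∀ w, K.formAt x w w = 0 := K.formInChart_self (mem_chart_target _ x)
  have h := hb (u + v)
  simp only [map_add, add_apply, hb] at h
  linarith

theorem formAt_I_smul_left (x : X) (u v : Cn n) :
    K.formAt x (Complex.I • u) v = -K.formAt x u (Complex.I • v) := by
  have h := K.formAt_I_smul x (Complex.I • u) v
  rw [smul_smul, Complex.I_mul_I, neg_one_smul, map_neg, neg_apply] at h
  exact h.symm

theorem formDeriv_I_smul_left (x : X) (u v w : Cn n) :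
    K.formDeriv x u (Complex.I • v) w = -K.formDeriv x u v (Complex.I • w) := by
  have h := K.formDeriv_I_smul x u (Complex.I • v) w
  rw [smul_smul, Complex.I_mul_I, neg_one_smul, map_neg, neg_apply] at h
  exact h.symm

/-- The Christoffel symbols at `x` as a vector of `ℂⁿ`. -/
def christoffelAt (x : X) (u v : Cn n) : Cn n := K.christoffel x u v

/-- `ω(V, J Γ(u, v)) = g(Γ(u, v), V)`, expressed by the derivatives of `ω`. -/
theorem formAt_I_smul_christoffelAt (x : X) (V u v : Cn n) :
    K.formAt x V (Complex.I • K.christoffelAt x u v) =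
      (1 / 2 : ℝ) * (K.formDeriv x u v (Complex.I • V) + K.formDeriv x v u (Complex.I • V)
        - K.formDeriv x V u (Complex.I • v)) := by
  have h : K.form x (K.christoffelAt x u v) (Complex.I • V : Cn n) = K.christoffelFirst x u v V :=
    congrArg (fun a : Cn n →L[ℝ] ℝ => a V) (K.metric_christoffel x u v)
  have h' : K.formAt x (K.christoffelAt x u v) (Complex.I • V) = K.christoffelFirst x u v V :=
    (K.formInChart_self_point _ _).trans h
  rw [K.christoffelFirst_apply, K.metricDeriv_eq, K.metricDeriv_eq, K.metricDeriv_eq] at h'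
  rw [← h', K.formAt_swap, K.formAt_I_smul_left, neg_neg]

/-- The Christoffel symbols determined by `formAt_I_smul_christoffelAt`, applied to `J V` in place
of `V`. -/
theorem formAt_christoffelAt (x : X) (V u v : Cn n) :
    K.formAt x V (K.christoffelAt x u v) =
      -(1 / 2 : ℝ) * (K.formDeriv x u v V + K.formDeriv x v u V
        + K.formDeriv x (Complex.I • V) u (Complex.I • v)) := by
  have h := K.formAt_I_smul_christoffelAt x (Complex.I • V) u v
  rw [K.formAt_I_smul, smul_smul, Complex.I_mul_I, neg_one_smul, map_neg, map_neg] at h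
  rw [h]
  ring

variable (f : X → ℝ)

/-- The value at `x` of the Hamiltonian vector field, as a vector of `ℂⁿ`. -/
def hamiltonianAt (x : X) : Cn n := K.hamiltonian f x

/-- The derivative at `x` of the Hamiltonian vector field in the preferred chart at `x`. -/
def hamiltonianDeriv (x : X) : Cn n →L[ℝ] Cn n :=
  fderiv ℝ (fieldInChart (K.hamiltonian f) x) (chartAt (Cn n) x x)

theorem dbarSection_eq_formAt (x : X) (v : Cn n) :
    dbarSection f x v = (1 / 2 : ℂ) * ((K.formAt x (K.hamiltonianAt f x) v : ℂ)
      + Complex.I * (K.formAt x (K.hamiltonianAt f x) (Complex.I • v) : ℂ)) := by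
  have hdf : ∀ w : Cn n, differential f x w = K.formAt x (K.hamiltonianAt f x) w := fun w =>
    (congrArg (fun a : Cn n →L[ℝ] ℝ => a w) (K.form_hamiltonian f x).symm).trans
      (K.formInChart_self_point _ _).symm
  rw [dbarSection_apply, hdf, hdf]

variable {f} (hf : ContMDiff 𝓘(ℝ, Cn n) 𝓘(ℝ, ℝ) ∞ f)
include hf

/-- The product rule for `∂̄f = (ω(V_f, ·) + √-1 ω(V_f, J ·)) / 2`. -/
theorem fderiv_dbarSectionInChart (x : X) (u v : Cn n) :
    fderiv ℝ (oneFormInChart n (dbarSection f) (chartAt (Cn n) x)) (chartAt (Cn n) x x) u v =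
      (1 / 2 : ℂ) *
        (((K.formDeriv x u (K.hamiltonianAt f x) v
            + K.formAt x (K.hamiltonianDeriv f x u) v : ℝ) : ℂ) +
        Complex.I * ((K.formDeriv x u (K.hamiltonianAt f x) (Complex.I • v)
            + K.formAt x (K.hamiltonianDeriv f x u) (Complex.I • v) : ℝ) : ℂ)) := by
  -- the linear map sending `df` to `∂̄f`
  obtain ⟨P, hP⟩ : ∃ P : (Cn n →L[ℝ] ℝ) →L[ℝ] (Cn n →L[ℝ] ℂ),
      ∀ a v, P a v = (1 / 2 : ℂ) * ((a v : ℂ) + Complex.I * (a (Complex.I • v) : ℂ)) :=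
    ⟨(1 / 2 : ℂ) • (ContinuousLinearMap.compL ℝ (Cn n) ℝ ℂ Complex.ofRealCLM + Complex.I •
      (ContinuousLinearMap.compL ℝ (Cn n) ℝ ℂ Complex.ofRealCLM).comp
        ((ContinuousLinearMap.compL ℝ (Cn n) (Cn n) ℝ).flip
          (Complex.I • ContinuousLinearMap.id ℝ (Cn n)))), fun _ _ => rfl⟩
  have hV := (K.differentiableAt_hamiltonianInChart hf (mem_chart_target _ x)).hasFDerivAt
  have h1 := HasFDerivAt.comp (𝕜 := ℝ) (F := Cn n →L[ℝ] ℝ) (G := Cn n →L[ℝ] ℂ)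
    (chartAt (Cn n) x x) P.hasFDerivAt ((K.hasFDerivAt_formInChart x).clm_apply hV)
  have h2 := h1.congr_of_eventuallyEq
    (f₁ := oneFormInChart n (dbarSection f) (chartAt (Cn n) x)) <| by
    filter_upwards [eventually_mem_chartAt_target x] with z hz
    ext v
    have hz' := (chartAt (Cn n) x).map_target hz
    have hfd := hf.mdifferentiable (by simp)
    rw [oneFormInChart_apply _ hz, dbarSection_apply, ← compFrom_I_smul hz',
      differential_compFrom (hfd _) hz, differential_compFrom (hfd _) hz,
      ← K.formInChart_hamiltonian hfd hz]
    exact (hP _ _).symm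
  have hself : fieldInChart (K.hamiltonian f) x (chartAt (Cn n) x x) = K.hamiltonianAt f x :=
    fieldInChart_self _ x
  have hsum : ∀ w, (bilinInChart n K.form (chartAt (Cn n) x) (chartAt (Cn n) x x) ∘L
        fderiv ℝ (fieldInChart (K.hamiltonian f) x) (chartAt (Cn n) x x) +
      (K.formDeriv x).flip (fieldInChart (K.hamiltonian f) x (chartAt (Cn n) x x))) u w =
      K.formDeriv x u (K.hamiltonianAt f x) w + K.formAt x (K.hamiltonianDeriv f x u) w := by
    intro w
    rw [hself, add_comm]
    rfl
  rw [h2.fderiv, ← hsum, ← hsum]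
  exact hP _ _

/-- `(∇_u ∂̄f)(v)`, with the Levi-Civita connection rewritten by means of `dω = 0`. -/
theorem nabla_dbarSection (x : X) (u v : Cn n) :
    K.nabla (dbarSection f) x u v = (1 / 2 : ℂ) *
      (((K.formAt x (K.hamiltonianDeriv f x u) v
          + (1 / 2) * (K.formDeriv x (K.hamiltonianAt f x) u v
          + K.formDeriv x (Complex.I • K.hamiltonianAt f x) u (Complex.I • v)) : ℝ) : ℂ)
        + Complex.I * ((K.formAt x (K.hamiltonianDeriv f x u) (Complex.I • v)
          + (1 / 2) * (K.formDeriv x (K.hamiltonianAt f x) u (Complex.I • v)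
          - K.formDeriv x (Complex.I • K.hamiltonianAt f x) u v) : ℝ) : ℂ)) := by
  set V := K.hamiltonianAt f x with hV
  have e1 : K.formDeriv x u V v - K.formAt x V (K.christoffelAt x u v) =
      (1 / 2) * (K.formDeriv x V u v + K.formDeriv x (Complex.I • V) u (Complex.I • v)) := by
    rw [K.formAt_christoffelAt]
    linarith [K.formDeriv_cyclic x u V v, K.formDeriv_swap x u V v, K.formDeriv_swap x V v u,
      K.formDeriv_swap x v u V]
  have e2 : K.formDeriv x u V (Complex.I • v)
      - K.formAt x V (Complex.I • K.christoffelAt x u v) =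
      (1 / 2) * (K.formDeriv x V u (Complex.I • v) - K.formDeriv x (Complex.I • V) u v) := by
    rw [K.formAt_I_smul_christoffelAt]
    linarith [K.formDeriv_cyclic x u (Complex.I • V) v, K.formDeriv_swap x u (Complex.I • V) v,
      K.formDeriv_swap x (Complex.I • V) v u, K.formDeriv_I_smul_left x u V v]
  have h : K.nabla (dbarSection f) x u v =
      fderiv ℝ (oneFormInChart n (dbarSection f) (chartAt (Cn n) x)) (chartAt (Cn n) x x) u v
        - dbarSection f x (K.christoffelAt x u v) := rfl
  rw [h, K.fderiv_dbarSectionInChart hf, K.dbarSection_eq_formAt, ← hV]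
  have e1' := congrArg (fun r : ℝ => (r : ℂ)) e1
  have e2' := congrArg (fun r : ℝ => (r : ℂ)) e2
  push_cast at e1' e2' ⊢
  linear_combination (1 / 2 : ℂ) * e1' + (1 / 2 : ℂ) * Complex.I * e2'

/-- With `E u = J D_u V_f - D_{J u} V_f`, the number `4 (∇^{0,1}_u ∂̄f)(v)` is
`ω(E u, J v) - √-1 ω(E u, v)`: the terms with derivatives of `ω` cancel by its `J`-invariance. -/
theorem nabla01_dbarSection (x : X) (u v : Cn n) :
    K.nabla01 (dbarSection f) x u v = (1 / 4 : ℂ) *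
      ((K.formAt x (Complex.I • K.hamiltonianDeriv f x u
          - K.hamiltonianDeriv f x (Complex.I • u)) (Complex.I • v) : ℂ)
        - Complex.I * (K.formAt x (Complex.I • K.hamiltonianDeriv f x u
          - K.hamiltonianDeriv f x (Complex.I • u)) v : ℂ)) := by
  have h : K.nabla01 (dbarSection f) x u v = (1 / 2 : ℂ) * (K.nabla (dbarSection f) x u v
      + Complex.I * K.nabla (dbarSection f) x (Complex.I • u : Cn n) v) := rfl
  rw [h, K.nabla_dbarSection hf, K.nabla_dbarSection hf]
  rw [map_sub, sub_apply, sub_apply, K.formAt_I_smul, K.formAt_I_smul_left,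
    K.formDeriv_I_smul_left x (K.hamiltonianAt f x) u v,
    K.formDeriv_I_smul x (K.hamiltonianAt f x) u v,
    K.formDeriv_I_smul_left x (Complex.I • K.hamiltonianAt f x) u v,
    K.formDeriv_I_smul x (Complex.I • K.hamiltonianAt f x) u v]
  push_cast
  linear_combination (1 / 4 : ℂ) *
    (K.formAt x (K.hamiltonianDeriv f x (Complex.I • u)) (Complex.I • v) + (1 / 2) * (
    K.formDeriv x (K.hamiltonianAt f x) u v
    + K.formDeriv x (Complex.I • K.hamiltonianAt f x) u (Complex.I • v))) * Complex.I_sq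

theorem nabla01_dbarSection_eq_zero_iff (x : X) :
    (∀ u v : RealTangent n x, K.nabla01 (dbarSection f) x u v = 0) ↔
      ∀ u : Cn n,
        K.hamiltonianDeriv f x (Complex.I • u) = Complex.I • K.hamiltonianDeriv f x u := by
  constructor
  · intro h u
    -- the imaginary part alone already determines `E u`, as `ω` is nondegenerate
    have him : ∀ a b : ℝ, (1 / 4 : ℂ) * (a - Complex.I * b) = 0 → b = 0 := fun a b hab => by
      simpa using congrArg Complex.im hab
    have hE : K.formAt x (Complex.I • K.hamiltonianDeriv f x u
        - K.hamiltonianDeriv f x (Complex.I • u)) = 0 := by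
      ext v
      exact him _ _ ((K.nabla01_dbarSection hf x u v).symm.trans (h u v))
    exact (sub_eq_zero.1 (K.formInChart_nondegenerate (mem_chart_target _ x) _ hE)).symm
  · intro h
    have h0 : ∀ u v : Cn n, K.nabla01 (dbarSection f) x u v = 0 := fun u v => by
      rw [K.nabla01_dbarSection hf x u v, h u, sub_self, map_zero]
      simp
    exact h0

end KahlerForm

end Connection

/-! ### Lie derivative of the complex structure and holomorphic vector fields -/

section VectorFields

theorem toHolTangent_part10 (V : ∀ y : X, RealTangent n y) (x : X) :
    toHolTangent x (part10 V x) = V x := by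
  have h : ∀ v : Cn n, TensorProduct.lift
      ((LinearMap.lsmul ℂ (Cn n)).restrictScalars₁₂ ℝ ℝ : ℂ →ₗ[ℝ] Cn n →ₗ[ℝ] Cn n)
      ((1 / 2 : ℂ) • ((1 : ℂ) ⊗ₜ[ℝ] v - Complex.I ⊗ₜ[ℝ] (Complex.I • v))) = v := by
    intro v
    rw [smul_sub, TensorProduct.smul_tmul', TensorProduct.smul_tmul', map_sub,
      TensorProduct.lift.tmul, TensorProduct.lift.tmul]
    simp only [LinearMap.restrictScalars₁₂_apply_apply, LinearMap.lsmul_apply, smul_eq_mul,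
      smul_smul, mul_assoc, Complex.I_mul_I]
    rw [← sub_smul]
    norm_num
  exact h _

theorem isType10_part10 (V : ∀ y : X, RealTangent n y) (x : X) : IsType10 x (part10 V x) := by
  have h : ∀ v : Cn n, LinearMap.baseChange ℂ
      (Complex.I • LinearMap.id : Cn n →ₗ[ℝ] Cn n)
      ((1 / 2 : ℂ) • ((1 : ℂ) ⊗ₜ[ℝ] v - Complex.I ⊗ₜ[ℝ] (Complex.I • v))) =
      Complex.I • (1 / 2 : ℂ) • ((1 : ℂ) ⊗ₜ[ℝ] v - Complex.I ⊗ₜ[ℝ] (Complex.I • v)) := by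
    intro v
    rw [map_smul, map_sub, LinearMap.baseChange_tmul, LinearMap.baseChange_tmul,
      smul_comm Complex.I]
    congr 1
    rw [smul_sub, TensorProduct.smul_tmul', TensorProduct.smul_tmul']
    simp only [LinearMap.smul_apply, LinearMap.id_apply, smul_smul, smul_eq_mul, mul_one,
      Complex.I_mul_I, neg_one_smul, TensorProduct.tmul_neg, TensorProduct.neg_tmul]
    abel
  exact h _

variable [IsManifold 𝓘(ℂ, Cn n) ω X]

/-- Mathlib's Lie bracket is defined by pullback along the extended chart; this pullback is the
chart expression of the field. -/
theorem mpullbackWithin_extChartAt_symm (V : ∀ y : X, RealTangent n y) {x : X} {z : Cn n}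
    (hz : z ∈ (chartAt (Cn n) x).target) :
    VectorField.mpullbackWithin 𝓘(ℝ, Cn n) 𝓘(ℝ, Cn n) (extChartAt 𝓘(ℝ, Cn n) x).symm V
      (Set.range 𝓘(ℝ, Cn n)) z = fieldInChart V x z := by
  have hy := (chartAt (Cn n) x).map_target hz
  let A : Cn n →L[ℝ] Cn n := mfderivWithin 𝓘(ℝ, Cn n) 𝓘(ℝ, Cn n) (extChartAt 𝓘(ℝ, Cn n) x).symm
    (Set.range 𝓘(ℝ, Cn n)) z
  have hA : A = compFrom n x ((chartAt (Cn n) x).symm z) := by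
    rw [← dChartSymm_chartAt x hz]
    simp only [A, modelWithCornersSelf_coe, Set.range_id, mfderivWithin_univ]
    rfl
  have hinv : A.inverse = compTo n x ((chartAt (Cn n) x).symm z) := by
    rw [hA]
    exact ContinuousLinearMap.inverse_eq
      (ContinuousLinearMap.ext fun v => compFrom_compTo hy v)
      (ContinuousLinearMap.ext fun v => compTo_compFrom hy v)
  change A.inverse (V ((chartAt (Cn n) x).symm z)) = _
  rw [hinv]
  rfl

theorem mlieBracket_eq_fieldInChart (V W : ∀ y : X, RealTangent n y) (x : X) :
    VectorField.mlieBracket 𝓘(ℝ, Cn n) V W x =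
      (fderiv ℝ (fieldInChart W x) (chartAt (Cn n) x x) (fieldInChart V x (chartAt (Cn n) x x))
        - fderiv ℝ (fieldInChart V x) (chartAt (Cn n) x x)
          (fieldInChart W x (chartAt (Cn n) x x)) : Cn n) := by
  let P (U : ∀ y : X, RealTangent n y) : Cn n → Cn n :=
    VectorField.mpullbackWithin 𝓘(ℝ, Cn n) 𝓘(ℝ, Cn n) (extChartAt 𝓘(ℝ, Cn n) x).symm U
      (Set.range 𝓘(ℝ, Cn n))
  have hev : ∀ U, P U =ᶠ[𝓝 (chartAt (Cn n) x x)] fieldInChart U x := fun U =>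
    (eventually_mem_chartAt_target x).mono fun z hz => mpullbackWithin_extChartAt_symm U hz
  rw [← VectorField.mlieBracketWithin_univ, VectorField.mlieBracketWithin_apply,
    mfderiv_extChartAt_self]
  have hset : (extChartAt 𝓘(ℝ, Cn n) x).symm ⁻¹' Set.univ ∩ Set.range 𝓘(ℝ, Cn n) = Set.univ := by
    simp
  change (ContinuousLinearMap.id ℝ (Cn n)).inverse (VectorField.lieBracketWithin ℝ (P V) (P W)
    ((extChartAt 𝓘(ℝ, Cn n) x).symm ⁻¹' Set.univ ∩ Set.range 𝓘(ℝ, Cn n))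
    (chartAt (Cn n) x x)) = _
  rw [ContinuousLinearMap.inverse_id, ContinuousLinearMap.id_apply, hset,
    VectorField.lieBracketWithin_univ, (hev V).lieBracket_vectorField_eq (hev W),
    VectorField.lieBracket_eq]

theorem fieldInChart_J (W : ∀ y : X, RealTangent n y) {x : X} {z : Cn n}
    (hz : z ∈ (chartAt (Cn n) x).target) :
    fieldInChart (fun y => J n y (W y)) x z = Complex.I • fieldInChart W x z :=
  compTo_I_smul ((chartAt (Cn n) x).map_target hz) _

/-- `L_V J` is tensorial: its value at `x` is the failure of the derivative of `V` to be complex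
linear, applied to `W x`. -/
theorem lieDerivJ_eq (V W : ∀ y : X, RealTangent n y) (x : X) :
    lieDerivJ V W x =
      (Complex.I • fderiv ℝ (fieldInChart V x) (chartAt (Cn n) x x)
          (fieldInChart W x (chartAt (Cn n) x x))
        - fderiv ℝ (fieldInChart V x) (chartAt (Cn n) x x)
          (Complex.I • fieldInChart W x (chartAt (Cn n) x x)) : Cn n) := by
  have h1 : fderiv ℝ (fieldInChart (fun y => J n y (W y)) x) (chartAt (Cn n) x x) =
      Complex.I • fderiv ℝ (fieldInChart W x) (chartAt (Cn n) x x) := by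
    have hev : fieldInChart (fun y => J n y (W y)) x =ᶠ[𝓝 (chartAt (Cn n) x x)]
        Complex.I • fieldInChart W x :=
      (eventually_mem_chartAt_target x).mono fun z hz => fieldInChart_J W hz
    rw [hev.fderiv_eq, fderiv_const_smul_field]
    rfl
  have hJ := fieldInChart_J W (mem_chart_target (Cn n) x)
  rw [lieDerivJ, mlieBracket_eq_fieldInChart, mlieBracket_eq_fieldInChart, h1, hJ]
  change _ - Complex.I • (_ - _ : Cn n) = _
  rw [smul_sub, smul_apply]
  abel

theorem preservesComplexStructure_iff (V : ∀ y : X, RealTangent n y) :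
    PreservesComplexStructure V ↔ ∀ (x : X) (u : Cn n),
      fderiv ℝ (fieldInChart V x) (chartAt (Cn n) x x) (Complex.I • u) =
        Complex.I • fderiv ℝ (fieldInChart V x) (chartAt (Cn n) x x) u := by
  constructor
  · intro h x u
    -- every tangent vector `u` at `x` extends to a smooth local vector field
    have : IsManifold 𝓘(ℝ, Cn n) (∞ + 1) X := .of_le (n := ω) le_top
    have : ContMDiffVectorBundle ∞ (Cn n) (TangentSpace 𝓘(ℝ, Cn n) : X → Type _) 𝓘(ℝ, Cn n) :=
      TangentBundle.contMDiffVectorBundle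
    obtain ⟨s, hs, hsm⟩ := FiberBundle.exists_contMDiffOn_extend (k := ∞) 𝓘(ℝ, Cn n) (Cn n)
      (V := (TangentSpace 𝓘(ℝ, Cn n) : X → Type _)) (x₀ := x) u
    obtain ⟨U, hUs, hU, hxU⟩ := mem_nhds_iff.1 hs
    have h0 := h U hU _ (hsm.mono hUs) x hxU
    have hu : fieldInChart (FiberBundle.extend (Cn n)
        (E := (TangentSpace 𝓘(ℝ, Cn n) : X → Type _)) (x := x) u) x (chartAt (Cn n) x x) = u :=
      (fieldInChart_self _ x).trans (FiberBundle.extend_apply_self _ _)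
    rw [lieDerivJ_eq, hu] at h0
    exact (sub_eq_zero.1 h0).symm
  · intro h U _ W _ x _
    rw [lieDerivJ_eq, h, sub_self]
    rfl

/-- The holomorphic and the real tangent bundle have the same fibres and, by
`tangentCoordChange_real_eq`, the same coordinate changes, so `fieldInChart` serves both. -/
theorem mdifferentiableAt_holTangent_iff (V : ∀ y : X, HolTangent n y) (x : X) :
    MDifferentiableAt 𝓘(ℂ, Cn n) (𝓘(ℂ, Cn n).prod 𝓘(ℂ, Cn n))
      (fun x => (⟨x, V x⟩ : TangentBundle 𝓘(ℂ, Cn n) X)) x ↔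
    DifferentiableAt ℂ (fieldInChart V x) (chartAt (Cn n) x x) := by
  rw [mdifferentiableAt_section, mdifferentiableAt_iff_source_of_mem_source (mem_chart_source _ x)]
  simp only [modelWithCornersSelf_coe, Set.range_id, mdifferentiableWithinAt_univ,
    mdifferentiableAt_iff_differentiableAt]
  refine Filter.EventuallyEq.differentiableAt_iff ?_
  filter_upwards [eventually_mem_chartAt_target x] with z hz
  have hy := (chartAt (Cn n) x).map_target hz
  have h := tangentCoordChange_real_eq _ x _ (mem_chart_source (Cn n) _) hy
  exact congrArg (fun a : Cn n →L[ℝ] Cn n => a (V ((chartAt (Cn n) x).symm z))) h.symm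

/-- A real differentiable map is complex differentiable exactly when its derivative commutes with
multiplication by `√-1`. -/
theorem differentiableAt_complex_iff_fderiv_I_smul {E F : Type*} [NormedAddCommGroup E]
    [NormedSpace ℂ E] [NormedAddCommGroup F] [NormedSpace ℂ F] {g : E → F} {z : E}
    (hg : DifferentiableAt ℝ g z) :
    DifferentiableAt ℂ g z ↔
      ∀ u, fderiv ℝ g z (Complex.I • u) = Complex.I • fderiv ℝ g z u := by
  rw [differentiableAt_iff_restrictScalars ℝ hg]
  constructor
  · rintro ⟨g', hg'⟩ u
    rw [← hg']
    exact map_smul g' _ _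
  · intro h
    refine ⟨⟨⟨(fderiv ℝ g z : E →ₗ[ℝ] F).toAddHom, fun c u => ?_⟩, (fderiv ℝ g z).cont⟩, rfl⟩
    change fderiv ℝ g z (c • u) = c • fderiv ℝ g z u
    conv_lhs => rw [← Complex.re_add_im c]
    conv_rhs => rw [← Complex.re_add_im c]
    rw [add_smul, add_smul, mul_smul, mul_smul, map_add, Complex.coe_smul, Complex.coe_smul,
      Complex.coe_smul, Complex.coe_smul, map_smul, map_smul, h]

theorem isHolomorphic10_hamiltonian_iff (K : KahlerForm n X) {f : X → ℝ}
    (hf : ContMDiff 𝓘(ℝ, Cn n) 𝓘(ℝ, ℝ) ∞ f) :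
    IsHolomorphic10 (part10 (K.hamiltonian f)) ↔ ∀ (x : X) (u : Cn n),
      K.hamiltonianDeriv f x (Complex.I • u) = Complex.I • K.hamiltonianDeriv f x u := by
  have h1 : ∀ x, toHolTangent x (part10 (K.hamiltonian f) x) = K.hamiltonian f x :=
    toHolTangent_part10 _
  simp only [IsHolomorphic10, isType10_part10, implies_true, true_and, h1]
  refine forall_congr' fun x => (mdifferentiableAt_holTangent_iff _ x).trans ?_
  exact differentiableAt_complex_iff_fderiv_I_smul
    (K.differentiableAt_hamiltonianInChart hf (mem_chart_target _ x))

end VectorFields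

end KahlerGeometry

end

theorem mainTheorem9 (n : ℕ) {X : Type*} [TopologicalSpace X]
    [ChartedSpace (KahlerGeometry.Cn n) X]
    [IsManifold 𝓘(ℂ, KahlerGeometry.Cn n) ω X]
    (K : KahlerGeometry.KahlerForm n X) (f : X → ℝ)
    (hf : ContMDiff 𝓘(ℝ, KahlerGeometry.Cn n) 𝓘(ℝ, ℝ) ∞ f) :
    (KahlerGeometry.PreservesComplexStructure (K.hamiltonian f) ↔
      ∀ (x : X) (u v : KahlerGeometry.RealTangent n x),
        K.nabla01 (KahlerGeometry.dbarSection f) x u v = 0) ∧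
    ((∀ (x : X) (u v : KahlerGeometry.RealTangent n x),
        K.nabla01 (KahlerGeometry.dbarSection f) x u v = 0) ↔
      KahlerGeometry.IsHolomorphic10 (KahlerGeometry.part10 (K.hamiltonian f))) := by
  have h2 : (∀ (x : X) (u v : KahlerGeometry.RealTangent n x),
      K.nabla01 (KahlerGeometry.dbarSection f) x u v = 0) ↔ _ :=
    forall_congr' fun x => K.nabla01_dbarSection_eq_zero_iff hf x
  exact ⟨(KahlerGeometry.preservesComplexStructure_iff _).trans h2.symm,
    h2.trans (KahlerGeometry.isHolomorphic10_hamiltonian_iff K hf).symm⟩
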